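/- \textbf{Lemma (Adjacent Strips).} Let $n_x,n_y\ge 2$ and let $C$ be a lattice quadrilateral cap over the rectangle $B=[1,n_x]\times[1,n_y]$: every lattice point $(x,y)\in B$ is given a height $z(x,y)\in\mathbb R$, for every unit lattice cell of $B$ the four points $(x,y,z(x,y))$ over its corners are coplanar, and $C$ is the union of the quadrilaterals spanned by these quadruples. Assume that $C$ is convex, i.e. $C$ is the upper surface of its convex hull. For $1\le y<n_y$ the $x$-strip $S_y$ consists of the quadrilaterals over the cells $[x,x+1]\times[y,y+1]$, $1\le x<n_x$. A planar unfolding of $S_y$ places each of its quadrilaterals congruently in the plane with its upper side facing up, so that consecutive quadrilaterals stay attached along their common edge; it is unique up to a rigid motion of the plane. Its two boundary chains are the images of the edge paths of $C$ over the lattice points $(1,y),\dots,(n_x,y)$ and $(1,y+1),\dots,(n_x,y+1)$. A planar chain $p_1,\dots,p_n$ is radially monotone if $\angle p_j\,p_i\,p_{i+1}\ge \pi/2$ for all $1\le j<i<n$. Assume that $C$ is radially monotone, i.e. both boundary chains of the unfolding of every $x$-strip are radially monotone. Unfold $C$ by cutting all edges in the $x$-direction on interior lattice lines except those between $x=1$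 and $x=2$: each strip $S_y$ is unfolded in the plane, and $S_y$ and $S_{y+1}$ stay attached along their common edge over the segment from $(1,y+1)$ to $(2,y+1)$. Then the planar unfoldings of any two adjacent $x$-strips $S_y$ and $S_{y+1}$ ($1\le y$, $y+2\le n_y$) do not overlap, i.e. the two regions of the plane that they cover have disjoint interiors. -/

import Mathlib

noncomputable section

namespace QuadCap

/-- Euclidean three-space; the coordinates `0`, `1`, `2` are `x`, `y`, `z`. -/
abbrev Space := EuclideanSpace ℝ (Fin 3)

/-- The Euclidean plane in which the surface is unfolded. -/
abbrev Plane := EuclideanSpace ℝ (Fin 2)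

/-- The four corners of the unit lattice cell `[x, x+1] × [y, y+1]`, counterclockwise. -/
def corner (x y : ℕ) : Fin 4 → ℕ × ℕ :=
  ![(x, y), (x + 1, y), (x + 1, y + 1), (x, y + 1)]

/-- The point at height `z (x, y)` over the lattice point `(x, y)`. -/
def lift (z : ℕ × ℕ → ℝ) (v : ℕ × ℕ) : Space := !₂[(v.1 : ℝ), (v.2 : ℝ), z v]

/-- A lattice quadrilateral cap over the rectangle `[1, nx] × [1, ny]`: a height for each lattice
point, such that the four corners over each unit lattice cell are coplanar, and hence span a
quadrilateral.  Only the heights over lattice points of the rectangle matter. -/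
structure Cap where
  nx : ℕ
  ny : ℕ
  two_le_nx : 2 ≤ nx
  two_le_ny : 2 ≤ ny
  z : ℕ × ℕ → ℝ
  coplanar : ∀ x y, 1 ≤ x → x < nx → 1 ≤ y → y < ny →
    Coplanar ℝ (Set.range fun i => lift z (corner x y i))

namespace Cap

variable (C : Cap)

/-- The vertex of the cap over the lattice point `v`. -/
def vertex (v : ℕ × ℕ) : Space := lift C.z v

/-- The quadrilateral of the cap over the lattice cell `[x, x+1] × [y, y+1]`. -/
def quad (x y : ℕ) : Set Space :=
  convexHull ℝ (Set.range fun i => C.vertex (corner x y i))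

/-- The surface: the union of all the quadrilaterals. -/
def surface : Set Space :=
  {p | ∃ x y, 1 ≤ x ∧ x < C.nx ∧ 1 ≤ y ∧ y < C.ny ∧ p ∈ C.quad x y}

/-- The cap is convex: it is the upper surface of its convex hull, that is, no point of the convex
hull lies strictly above a point of the surface. -/
def IsConvex : Prop :=
  ∀ p ∈ C.surface, ∀ q ∈ convexHull ℝ C.surface, q 0 = p 0 → q 1 = p 1 → q 2 ≤ p 2

/-- Twice the signed area of the triangle `a b c`; positive iff `a b c` is counterclockwise. -/
def cross (a b c : Plane) : ℝ :=
  (b 0 - a 0) * (c 1 - a 1) - (b 1 - a 1) * (c 0 - a 0)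

/-- `P` is a planar unfolding of the `x`-strip between `y` and `y + 1`, given by the positions
`P (x, y)` and `P (x, y + 1)` of its vertices: each quadrilateral of the strip is placed
congruently (all distances between its corners are kept), with the upper side of the surface
facing up (counterclockwise corners stay counterclockwise).  Consecutive quadrilaterals share the
images of the two ends of their common edge. -/
def IsStripUnfolding (y : ℕ) (P : ℕ × ℕ → Plane) : Prop :=
  ∀ x, 1 ≤ x → x < C.nx →
    (∀ i j : Fin 4, dist (P (corner x y i)) (P (corner x y j)) =
      dist (C.vertex (corner x y i)) (C.vertex (corner x y j))) ∧
    0 < cross (P (x, y)) (P (x + 1, y)) (P (x, y + 1))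

/-- The region of the plane covered by the strip between `y` and `y + 1` when its vertices are
placed by `P`: the union of the placed quadrilaterals. -/
def stripRegion (y : ℕ) (P : ℕ × ℕ → Plane) : Set Plane :=
  {p | ∃ x, 1 ≤ x ∧ x < C.nx ∧ p ∈ convexHull ℝ (Set.range fun i => P (corner x y i))}

/-- `P` is a planar unfolding of the whole cap in which all the edges in the `x`-direction on
interior lattice lines are cut, except those between `x = 1` and `x = 2`: `P y` is an unfolding
of the strip between `y` and `y + 1`, and two adjacent strips stay attached along their common
edge between `x = 1` and `x = 2`. -/
def IsUnfolding (P : ℕ → ℕ × ℕ → Plane) : Prop :=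
  (∀ y, 1 ≤ y → y < C.ny → C.IsStripUnfolding y (P y)) ∧
  (∀ y, 1 ≤ y → y + 1 < C.ny →
    P y (1, y + 1) = P (y + 1) (1, y + 1) ∧ P y (2, y + 1) = P (y + 1) (2, y + 1))

end Cap

/-- A planar chain with vertices `c 1, …, c n` is radially monotone: for any vertex `c j` and any
later vertex `c i` that is not the last, the angle `c j, c i, c (i + 1)` at `c i` is at least
`π / 2`. -/
def RadiallyMonotoneChain (n : ℕ) (c : ℕ → Plane) : Prop :=
  ∀ j i, 1 ≤ j → j < i → i + 1 ≤ n →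
    Real.pi / 2 ≤ EuclideanGeometry.angle (c j) (c i) (c (i + 1))

/-- The cap is radially monotone: in the unfolding of each `x`-strip, both boundary chains (the
images of the `x`-chains at `y` and at `y + 1`) are radially monotone.  (The unfolding of a strip
is unique up to a rigid motion of the plane.) -/
def Cap.IsRadiallyMonotone (C : Cap) : Prop :=
  ∀ y, 1 ≤ y → y < C.ny → ∀ P, C.IsStripUnfolding y P →
    RadiallyMonotoneChain C.nx (fun x => P (x, y)) ∧
    RadiallyMonotoneChain C.nx (fun x => P (x, y + 1))

end QuadCap

end

/-!
Coplanarity makes every cell a parallelogram, so the height is `f x + g y`. Write `p` and `q` for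
the slopes of `f` and `g` over unit segments; by convexity both decrease. An unfolded strip is
therefore swept out by translating a planar chain along one fixed vector, and an edge of slope `p`
encloses with the right normal of that vector the angle
`edgeAngle q p = arctan (p q / √(1 + p² + q²))`.

The common boundary of two adjacent strips with slopes `q ≥ r` unfolds into two chains with equal
edge lengths and the same first edge. If `q ≥ 0 ≥ r`, then the lower chain turns to the right and
the upper chain to the left, and the line through the common edge separates the strips. If
`q ≥ r ≥ 0`, then both chains turn to the right, and the lower one turns further at each vertex,
since `edgeAngle q p - edgeAngle r p` increases with `p` (`monotone_edgeAngle_sub`). The case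
`0 ≥ q ≥ r` is its mirror image.

For `q ≥ r ≥ 0` it is shown that the whole lower strip lies to the right of the line through each
edge of the upper chain, while the cell over that edge lies to its left. The essential point
is that the vertices of the lower chain lie to the right of these lines (`sum_sin_le_sum_sin`). The
upper chain becomes the lower one by closing its vertices one after the other, starting with the
first. Each step rotates to the right, about one of its vertices, an end of the chain that is
still congruent to the end of the upper chain. The height of that end above this vertex in a fixed
normal direction (`tailSupport`) decreases under the rotation: its derivative is, up to sign, the
component of the chord from the vertex to the highest point along the chain at that point, and
radial monotonicity says that this is nonnegative (`monotoneOn_tailSupport`).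
-/

namespace QuadCap

/-! ### Opening a radially monotone chain -/

open Finset in
/-- The support function of the end of a chain, beginning at its vertex `j`, seen from that vertex:
the `m`-th edge has length `l m` and is turned to the right by `b m`, and the direction is the left
normal of the direction turned to the right by `t`. Edges turned further than `t` do
not count: they only descend from the highest vertex, if the chain turns by less than `π` in
total. -/
noncomputable def tailSupport (l b : ℕ → ℝ) (N j : ℕ) (t : ℝ) : ℝ :=
  ∑ m ∈ Ico j N, l m * Real.sin (max (t - b m) 0)

/-- A direction between two directions with which a vector encloses an angle of at most `π / 2`
has the same property; the vector is given as a sum of edges. -/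
theorem sum_cos_nonneg_of_mem_Icc (l b : ℕ → ℝ) (s : Finset ℕ) {u v t : ℝ} (hut : u ≤ t)
    (htv : t ≤ v) (hvu : v - u < Real.pi) (hu : 0 ≤ ∑ m ∈ s, l m * Real.cos (u - b m))
    (hv : 0 ≤ ∑ m ∈ s, l m * Real.cos (v - b m)) :
    0 ≤ ∑ m ∈ s, l m * Real.cos (t - b m) := by
  rcases (hut.trans htv).eq_or_lt with h | h
  · have : t = u := le_antisymm (h ▸ htv) hut
    rwa [this]
  have hs : 0 < Real.sin (v - u) := Real.sin_pos_of_pos_of_lt_pi (by linarith) hvu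
  have key : Real.sin (v - u) * ∑ m ∈ s, l m * Real.cos (t - b m) =
      Real.sin (v - t) * (∑ m ∈ s, l m * Real.cos (u - b m)) +
        Real.sin (t - u) * ∑ m ∈ s, l m * Real.cos (v - b m) := by
    simp only [Finset.mul_sum, ← Finset.sum_add_distrib]
    refine Finset.sum_congr rfl fun m _ => ?_
    have h1 : Real.sin (v - u) =
        Real.sin (v - t) * Real.cos (t - u) + Real.cos (v - t) * Real.sin (t - u) := by
      rw [← Real.sin_add]; congr 1; ring
    have h2 : Real.cos (u - b m) =
        Real.cos (t - b m) * Real.cos (t - u) + Real.sin (t - b m) * Real.sin (t - u) := by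
      rw [← Real.cos_sub]; congr 1; ring
    have h3 : Real.cos (v - b m) =
        Real.cos (t - b m) * Real.cos (v - t) - Real.sin (t - b m) * Real.sin (v - t) := by
      rw [← Real.cos_add]; congr 1; ring
    rw [h1, h2, h3]
    ring
  have h1 : 0 ≤ Real.sin (v - t) :=
    Real.sin_nonneg_of_nonneg_of_le_pi (by linarith) (by linarith)
  have h2 : 0 ≤ Real.sin (t - u) :=
    Real.sin_nonneg_of_nonneg_of_le_pi (by linarith) (by linarith)
  refine nonneg_of_mul_nonneg_right (b := ∑ m ∈ s, l m * Real.cos (t - b m)) ?_ hs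
  rw [key]
  positivity

/-- The support function of the end of a radially monotone chain increases: its derivative is the
component of a chord of the chain along an edge, or along a direction between two successive
edges, at the end of that chord. -/
theorem monotoneOn_tailSupport (l b : ℕ → ℝ) (N : ℕ) (hl : ∀ m, 0 ≤ l m)
    (hb : ∀ i j, i ≤ j → j < N → b i ≤ b j) (hpi : ∀ j, j < N → b j - b 0 < Real.pi)
    (hrad : ∀ j i, j < i → i < N → 0 ≤ ∑ m ∈ Finset.Ico j i, l m * Real.cos (b i - b m))
    (j n : ℕ) (hjn : j ≤ n) (hn : n < N) :
    MonotoneOn (tailSupport l b N j) (Set.Iic (b n)) := by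
  induction n, hjn using Nat.le_induction with
  | base =>
    intro s hs t ht _
    have h0 : ∀ r ∈ Set.Iic (b j), tailSupport l b N j r = 0 := by
      intro r hr
      refine Finset.sum_eq_zero fun m hm => ?_
      rw [Finset.mem_Ico] at hm
      have := hb j m hm.1 hm.2
      rw [max_eq_right (by linarith [Set.mem_Iic.1 hr]), Real.sin_zero, mul_zero]
    rw [h0 s hs, h0 t ht]
  | succ n hjn ih =>
    have hbn := hb n (n + 1) (Nat.le_succ n) hn
    have hpin : b (n + 1) - b n < Real.pi := by
      linarith [hpi _ hn, hb 0 n (Nat.zero_le _) (by omega)]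
    rw [← Set.Iic_union_Icc_eq_Iic hbn]
    refine MonotoneOn.union_right (c := b n) (ih (by omega)) ?_ isGreatest_Iic (isLeast_Icc hbn)
    have hF : ∀ r ∈ Set.Icc (b n) (b (n + 1)), tailSupport l b N j r =
        ∑ m ∈ Finset.Ico j (n + 1), l m * Real.sin (r - b m) := by
      intro r hr
      rw [tailSupport, ← Finset.sum_Ico_consecutive _ (by omega : j ≤ n + 1) (by omega)]
      rw [Finset.sum_eq_zero (s := Finset.Ico (n + 1) N), add_zero]
      · refine Finset.sum_congr rfl fun m hm => ?_
        rw [Finset.mem_Ico] at hm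
        rw [max_eq_left (by linarith [hb m n (by omega) (by omega), hr.1])]
      · intro m hm
        rw [Finset.mem_Ico] at hm
        rw [max_eq_right (by linarith [hb (n + 1) m (by omega) (by omega), hr.2]),
          Real.sin_zero, mul_zero]
    intro s hs t ht hst
    rw [hF s hs, hF t ht, ← sub_nonneg, ← Finset.sum_sub_distrib]
    have hmid : 0 ≤ ∑ m ∈ Finset.Ico j (n + 1), l m * Real.cos ((s + t) / 2 - b m) := by
      refine sum_cos_nonneg_of_mem_Icc l b _ (u := b n) (v := b (n + 1))
        (by linarith [hs.1, ht.1]) (by linarith [hs.2, ht.2]) hpin ?_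
        (hrad j (n + 1) (by omega) hn)
      rw [Finset.sum_Ico_succ_top hjn, sub_self, Real.cos_zero, mul_one]
      refine add_nonneg ?_ (hl n)
      rcases hjn.eq_or_lt with h | h
      · rw [h, Finset.Ico_self, Finset.sum_empty]
      · exact hrad j n h (by omega)
    have hsin : 0 ≤ Real.sin ((t - s) / 2) :=
      Real.sin_nonneg_of_nonneg_of_le_pi (by linarith) (by linarith [hs.1, ht.2])
    have hsum : ∑ m ∈ Finset.Ico j (n + 1), (l m * Real.sin (t - b m) - l m * Real.sin (s - b m))
        = 2 * Real.sin ((t - s) / 2) *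
          ∑ m ∈ Finset.Ico j (n + 1), l m * Real.cos ((s + t) / 2 - b m) := by
      rw [Finset.mul_sum]
      refine Finset.sum_congr rfl fun m _ => ?_
      rw [← mul_sub, Real.sin_sub_sin]
      have h1 : (t - b m - (s - b m)) / 2 = (t - s) / 2 := by ring
      have h2 : (t - b m + (s - b m)) / 2 = (s + t) / 2 - b m := by ring
      rw [h1, h2]
      ring
    rw [hsum]
    positivity

/-- Two chains with the same edge lengths `l` start with the same edge and turn to the right only,
to the edge directions `a` and `b`; at each vertex the first turns at least as far as the second,
which is radially monotone.  Then the first chain lies to the right of the line through any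
edge `i` of the second: both sides are components along the left normal of that edge, of the
`k`-th vertex of the first chain and of the `i`-th vertex of the second. -/
theorem sum_sin_le_sum_sin (l a b : ℕ → ℝ) (N : ℕ) (hl : ∀ m, 0 ≤ l m)
    (ha : ∀ i j, i ≤ j → j < N → a i ≤ a j) (hb : ∀ i j, i ≤ j → j < N → b i ≤ b j)
    (hab : ∀ i j, i ≤ j → j < N → a i - b i ≤ a j - b j) (h0 : a 0 = b 0)
    (hpi : ∀ j, j < N → a j - a 0 < Real.pi)
    (hrad : ∀ j i, j < i → i < N → 0 ≤ ∑ m ∈ Finset.Ico j i, l m * Real.cos (b i - b m))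
    (i k : ℕ) (hi : i < N) (hk : k ≤ N) :
    ∑ j ∈ Finset.range k, l j * Real.sin (b i - a j) ≤
      ∑ j ∈ Finset.range i, l j * Real.sin (b i - b j) := by
  have hba : ∀ j, j < N → b j ≤ a j := fun j hj => by linarith [hab 0 j (Nat.zero_le _) hj]
  have hpib : ∀ j, j < N → b j - b 0 < Real.pi := fun j hj => by
    linarith [hba j hj, hpi j hj]
  have hbi := hb 0 i (Nat.zero_le _) hi
  -- The left side belongs to the chain that turns like the first one up to its edge `n` and like
  -- the second one from there on. The step from `n` to `n + 1` rotates a copy of the end of the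
  -- second chain to the right, about its vertex `n + 1`.
  have hH : ∀ n, n < N →
      ∑ j ∈ Finset.range n, l j * Real.sin (max (b i - a j) 0) +
        tailSupport l b N n (b i - (a n - b n)) ≤ tailSupport l b N 0 (b i) := by
    intro n
    induction n with
    | zero => intro _; simp [h0]
    | succ n ih =>
      intro hn
      refine le_trans ?_ (ih (by omega))
      have hsplit : tailSupport l b N n (b i - (a n - b n)) =
          l n * Real.sin (max (b i - a n) 0) +
            tailSupport l b N (n + 1) (b i - (a n - b n)) := by
        rw [tailSupport, Finset.sum_eq_sum_Ico_succ_bot (by omega), tailSupport]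
        congr 4
        ring
      have hd := hab n (n + 1) (Nat.le_succ n) hn
      have hdn := hba n (by omega)
      have hmono : tailSupport l b N (n + 1) (b i - (a (n + 1) - b (n + 1))) ≤
          tailSupport l b N (n + 1) (b i - (a n - b n)) := by
        have hN := hb i (N - 1) (by omega) (by omega)
        refine monotoneOn_tailSupport l b N hl hb hpib hrad (n + 1) (N - 1) (by omega) (by omega)
          ?_ ?_ (by linarith) <;> simp only [Set.mem_Iic] <;> linarith
      rw [Finset.sum_range_succ, hsplit]
      linarith
  have hfull : ∑ j ∈ Finset.range N, l j * Real.sin (max (b i - a j) 0) ≤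
      tailSupport l b N 0 (b i) := by
    have h := hH (N - 1) (by omega)
    have hN : N = N - 1 + 1 := by omega
    refine le_trans (le_of_eq ?_) h
    conv_lhs => rw [hN, Finset.sum_range_succ]
    congr 1
    rw [tailSupport]
    conv_rhs => rw [hN, Nat.add_sub_cancel, Nat.Ico_succ_singleton, Finset.sum_singleton]
    congr 3
    ring
  have hnn : ∀ j, j < N → 0 ≤ Real.sin (max (b i - a j) 0) := by
    intro j hj
    have := ha 0 j (Nat.zero_le _) hj
    refine Real.sin_nonneg_of_nonneg_of_le_pi (le_max_right _ _) (max_le ?_ Real.pi_pos.le)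
    linarith [hpib i hi]
  calc ∑ j ∈ Finset.range k, l j * Real.sin (b i - a j)
      ≤ ∑ j ∈ Finset.range k, l j * Real.sin (max (b i - a j) 0) := by
        refine Finset.sum_le_sum fun j hj => mul_le_mul_of_nonneg_left ?_ (hl j)
        have hj' : j < N := by have := Finset.mem_range.1 hj; omega
        rcases le_total 0 (b i - a j) with h | h
        · rw [max_eq_left h]
        · rw [max_eq_right h, Real.sin_zero]
          exact Real.sin_nonpos_of_nonpos_of_neg_pi_le h (by linarith [hpi j hj'])
    _ ≤ ∑ j ∈ Finset.range N, l j * Real.sin (max (b i - a j) 0) :=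
        Finset.sum_le_sum_of_subset_of_nonneg (by simpa using hk) fun j hj _ =>
          mul_nonneg (hl j) (hnn j (Finset.mem_range.1 hj))
    _ ≤ tailSupport l b N 0 (b i) := hfull
    _ = ∑ j ∈ Finset.range i, l j * Real.sin (b i - b j) := by
        rw [tailSupport, ← Finset.sum_Ico_consecutive _ (Nat.zero_le i) hi.le,
          Finset.sum_eq_zero (s := Finset.Ico i N), add_zero, Finset.range_eq_Ico]
        · refine Finset.sum_congr rfl fun m hm => ?_
          rw [Finset.mem_Ico] at hm
          rw [max_eq_left (by linarith [hb m i hm.2.le hi])]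
        · intro m hm
          rw [Finset.mem_Ico] at hm
          rw [max_eq_right (by linarith [hb i m hm.1 hm.2]), Real.sin_zero, mul_zero]

/-! ### The angles in an unfolded strip -/

/-- The direction of an edge in an unfolded strip: an edge of slope `p` in the `x`-direction rises
by this angle above the right normal of the edges of slope `q` in the `y`-direction. -/
noncomputable def edgeAngle (q p : ℝ) : ℝ := Real.arctan (p * q / √(1 + p ^ 2 + q ^ 2))

theorem edgeAngle_neg (q p : ℝ) : edgeAngle (-q) p = -edgeAngle q p := by
  simp [edgeAngle, neg_div, Real.arctan_neg]

theorem hasDerivAt_edgeAngle (q p : ℝ) :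
    HasDerivAt (edgeAngle q) (q / √(1 + p ^ 2 + q ^ 2) / (1 + p ^ 2)) p := by
  have hpos : 0 < 1 + p ^ 2 + q ^ 2 := by positivity
  have hS : 0 < √(1 + p ^ 2 + q ^ 2) := Real.sqrt_pos.2 hpos
  have hS2 := Real.sq_sqrt hpos.le
  have h1 : HasDerivAt (fun p : ℝ => 1 + p ^ 2 + q ^ 2) (2 * p) p := by
    simpa using ((hasDerivAt_pow 2 p).const_add 1).add_const (q ^ 2)
  have h := (((hasDerivAt_id p).mul_const q).div (h1.sqrt hpos.ne') hS.ne').arctan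
  refine h.congr_deriv ?_
  simp only [id, Pi.div_apply]
  generalize √(1 + p ^ 2 + q ^ 2) = S at *
  have hp : 0 < 1 + p ^ 2 := by positivity
  have hne : 1 + (p * q / S) ^ 2 ≠ 0 := by positivity
  have hne' : S ^ 2 + p ^ 2 * q ^ 2 ≠ 0 := by positivity
  field_simp
  rw [hS2]
  ring

theorem div_sqrt_le_div_sqrt {K q r : ℝ} (hK : 0 < K) (hr : 0 ≤ r) (hrq : r ≤ q) :
    r / √(K + r ^ 2) ≤ q / √(K + q ^ 2) := by
  rw [div_le_div_iff₀ (by positivity) (by positivity)]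
  refine le_of_sq_le_sq ?_ (mul_nonneg (hr.trans hrq) (Real.sqrt_nonneg _))
  rw [mul_pow, mul_pow, Real.sq_sqrt (by positivity), Real.sq_sqrt (by positivity)]
  nlinarith [mul_le_mul hrq hrq hr (hr.trans hrq)]

theorem monotone_edgeAngle {q : ℝ} (hq : 0 ≤ q) : Monotone (edgeAngle q) :=
  monotone_of_hasDerivAt_nonneg (hasDerivAt_edgeAngle q) fun p => by positivity

/-- Of two adjacent strips, the one with the larger slope in the `y`-direction turns further at each
vertex of their common boundary. -/
theorem monotone_edgeAngle_sub {q r : ℝ} (hr : 0 ≤ r) (hrq : r ≤ q) :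
    Monotone fun p => edgeAngle q p - edgeAngle r p := by
  refine monotone_of_hasDerivAt_nonneg
    (fun p => (hasDerivAt_edgeAngle q p).sub (hasDerivAt_edgeAngle r p)) fun p => ?_
  have := div_sqrt_le_div_sqrt (K := 1 + p ^ 2) (by positivity) hr hrq
  rw [Pi.zero_apply, ← sub_div]
  exact div_nonneg (sub_nonneg.2 this) (by positivity)

theorem sqrt_mul_cos_edgeAngle (q p : ℝ) :
    √(1 + p ^ 2) * Real.cos (edgeAngle q p) * √(1 + q ^ 2) = √(1 + p ^ 2 + q ^ 2) := by
  have h : 1 + (p * q / √(1 + p ^ 2 + q ^ 2)) ^ 2 =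
      (1 + p ^ 2) * (1 + q ^ 2) / (1 + p ^ 2 + q ^ 2) := by
    rw [div_pow, Real.sq_sqrt (by positivity)]
    field_simp
    ring
  rw [edgeAngle, Real.cos_arctan, h, Real.sqrt_div (by positivity), Real.sqrt_mul (by positivity)]
  field_simp

theorem sqrt_mul_sin_edgeAngle (q p : ℝ) :
    √(1 + p ^ 2) * Real.sin (edgeAngle q p) * √(1 + q ^ 2) = p * q := by
  have h := sqrt_mul_cos_edgeAngle q p
  have ht : Real.sin (edgeAngle q p) =
      p * q / √(1 + p ^ 2 + q ^ 2) * Real.cos (edgeAngle q p) := by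
    rw [edgeAngle, ← Real.tan_mul_cos (Real.cos_arctan_pos _).ne', Real.tan_arctan]
  have hS : √(1 + p ^ 2 + q ^ 2) ≠ 0 := by positivity
  rw [ht]
  field_simp
  linear_combination (p * q) * h

theorem edgeAngle_mem (q p : ℝ) :
    -(Real.pi / 2) < edgeAngle q p ∧ edgeAngle q p < Real.pi / 2 :=
  ⟨Real.neg_pi_div_two_lt_arctan _, Real.arctan_lt_pi_div_two _⟩

theorem edgeAngle_antitone_of_nonpos {q : ℝ} (hq : q ≤ 0) : Antitone (edgeAngle q) := by
  intro s t hst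
  have := monotone_edgeAngle (neg_nonneg.2 hq) hst
  rw [edgeAngle_neg, edgeAngle_neg] at this
  linarith

theorem monotone_edgeAngle_sub_of_nonpos {q r : ℝ} (hq : q ≤ 0) (hrq : r ≤ q) :
    Monotone fun p => edgeAngle q p - edgeAngle r p := by
  intro s t hst
  have := monotone_edgeAngle_sub (neg_nonneg.2 hq) (neg_le_neg hrq) hst
  simp only [edgeAngle_neg] at this
  simp only
  linarith

/-! ### The slopes of a cap -/

namespace Cap

variable (C : Cap)

/-- The slope of the cap in the `x`-direction between `x` and `x + 1`, on any lattice line. -/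
def slopeX (x : ℕ) : ℝ := C.z (x + 1, 1) - C.z (x, 1)

/-- The slope of the cap in the `y`-direction between `y` and `y + 1`, on any lattice line. -/
def slopeY (y : ℕ) : ℝ := C.z (1, y + 1) - C.z (1, y)

/-- The cells are parallelograms: opposite corners of a cell have the same midpoint. -/
theorem z_add_z {x y : ℕ} (hx : 1 ≤ x) (hx' : x < C.nx) (hy : 1 ≤ y) (hy' : y < C.ny) :
    C.z (x, y) + C.z (x + 1, y + 1) = C.z (x + 1, y) + C.z (x, y + 1) := by
  have h := C.coplanar x y hx hx' hy hy'
  rw [coplanar_iff_finrank_le_two,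
    finrank_vectorSpan_le_iff_not_affineIndependent ℝ _ (by simp)] at h
  by_contra hne
  refine h (affineIndependent_iff_of_fintype ℝ _ |>.2 fun w hw hw' => ?_)
  rw [Finset.weightedVSub_eq_linear_combination _ hw] at hw'
  have h0 := congrArg (fun v : Space => v 0) hw'
  have h1 := congrArg (fun v : Space => v 1) hw'
  have h2 := congrArg (fun v : Space => v 2) hw'
  simp [Fin.sum_univ_four, corner, lift] at h0 h1 h2 hw
  have e1 : w 1 = -w 2 := by linear_combination h0 - (x : ℝ) * hw
  have e3 : w 3 = -w 2 := by linear_combination h1 - (y : ℝ) * hw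
  have e0 : w 0 = w 2 := by linear_combination hw - e1 - e3
  have e2 : w 2 = 0 := by
    rw [e0, e1, e3] at h2
    have : w 2 * (C.z (x, y) + C.z (x + 1, y + 1) - (C.z (x + 1, y) + C.z (x, y + 1))) = 0 := by
      linear_combination h2
    exact (mul_eq_zero.1 this).resolve_right (sub_ne_zero.2 hne)
  intro i
  fin_cases i <;> simp [e0, e1, e2, e3]

theorem z_sub_z_eq_slopeX {x y : ℕ} (hx : 1 ≤ x) (hx' : x < C.nx) (hy : 1 ≤ y) (hy' : y ≤ C.ny) :
    C.z (x + 1, y) - C.z (x, y) = C.slopeX x := by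
  induction y, hy using Nat.le_induction with
  | base => rfl
  | succ y hy ih =>
    linarith [C.z_add_z hx hx' hy (by omega), ih (by omega)]

theorem z_sub_z_eq_slopeY {x y : ℕ} (hx : 1 ≤ x) (hx' : x ≤ C.nx) (hy : 1 ≤ y) (hy' : y < C.ny) :
    C.z (x, y + 1) - C.z (x, y) = C.slopeY y := by
  induction x, hx using Nat.le_induction with
  | base => rfl
  | succ x hx ih =>
    linarith [C.z_add_z hx (by omega) hy hy', ih (by omega)]

theorem vertex_mem_surface {x y : ℕ} (hx : 1 ≤ x) (hx' : x ≤ C.nx) (hy : 1 ≤ y)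
    (hy' : y ≤ C.ny) : C.vertex (x, y) ∈ C.surface := by
  have hnx := C.two_le_nx
  have hny := C.two_le_ny
  have key : ∀ a b : ℕ, 1 ≤ a → a < C.nx → 1 ≤ b → b < C.ny → ∀ i,
      C.vertex (corner a b i) ∈ C.surface := fun a b ha ha' hb hb' i =>
    ⟨a, b, ha, ha', hb, hb', subset_convexHull ℝ _ ⟨i, rfl⟩⟩
  rcases hx'.eq_or_lt with h1 | h1 <;> rcases hy'.eq_or_lt with h2 | h2
  · have := key (x - 1) (y - 1) (by omega) (by omega) (by omega) (by omega) 2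
    simpa [corner, Nat.sub_add_cancel hx, Nat.sub_add_cancel hy] using this
  · have := key (x - 1) y (by omega) (by omega) (by omega) (by omega) 1
    simpa [corner, Nat.sub_add_cancel hx] using this
  · have := key x (y - 1) (by omega) (by omega) (by omega) (by omega) 3
    simpa [corner, Nat.sub_add_cancel hy] using this
  · simpa [corner] using key x y hx h1 hy h2 0

/-- Convexity of the cap at a lattice point that is the midpoint of two others. -/
theorem IsConvex.z_add_z_le {C : Cap} (hC : C.IsConvex) {u v w : ℕ × ℕ}
    (hu : C.vertex u ∈ C.surface) (hv : C.vertex v ∈ C.surface) (hw : C.vertex w ∈ C.surface)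
    (h1 : (u.1 : ℝ) + w.1 = 2 * v.1) (h2 : (u.2 : ℝ) + w.2 = 2 * v.2) :
    C.z u + C.z w ≤ 2 * C.z v := by
  have hm := hC _ hv (midpoint ℝ (C.vertex u) (C.vertex w))
    ((convex_convexHull ℝ _).midpoint_mem (subset_convexHull ℝ _ hu) (subset_convexHull ℝ _ hw))
  simp [midpoint_eq_smul_add, vertex, lift] at hm
  linarith [hm (by linarith) (by linarith)]

theorem IsConvex.slopeX_succ_le {C : Cap} (hC : C.IsConvex) {x : ℕ} (hx : 1 ≤ x)
    (hx' : x + 1 < C.nx) : C.slopeX (x + 1) ≤ C.slopeX x := by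
  have hny := C.two_le_ny
  have := hC.z_add_z_le (u := (x, 1)) (v := (x + 1, 1)) (w := (x + 1 + 1, 1))
    (C.vertex_mem_surface hx (by omega) le_rfl (by omega))
    (C.vertex_mem_surface (by omega) (by omega) le_rfl (by omega))
    (C.vertex_mem_surface (by omega) (by omega) le_rfl (by omega))
    (by push_cast; ring) (by push_cast; ring)
  simp only [slopeX]
  linarith

theorem IsConvex.slopeY_succ_le {C : Cap} (hC : C.IsConvex) {y : ℕ} (hy : 1 ≤ y)
    (hy' : y + 1 < C.ny) : C.slopeY (y + 1) ≤ C.slopeY y := by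
  have hnx := C.two_le_nx
  have := hC.z_add_z_le (u := (1, y)) (v := (1, y + 1)) (w := (1, y + 1 + 1))
    (C.vertex_mem_surface le_rfl (by omega) hy (by omega))
    (C.vertex_mem_surface le_rfl (by omega) (by omega) (by omega))
    (C.vertex_mem_surface le_rfl (by omega) (by omega) (by omega))
    (by push_cast; ring) (by push_cast; ring)
  simp only [slopeY]
  linarith

theorem IsConvex.slopeX_le {C : Cap} (hC : C.IsConvex) {i j : ℕ} (hi : 1 ≤ i) (hij : i ≤ j)
    (hj : j < C.nx) : C.slopeX j ≤ C.slopeX i := by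
  induction j, hij using Nat.le_induction with
  | base => exact le_rfl
  | succ j hij ih => exact (hC.slopeX_succ_le (by omega) hj).trans (ih (by omega))

end Cap

/-! ### Parallelograms in the plane -/

/-- In the plane, a quadrilateral with the distances of a cell of slopes `p` and `q` is a
parallelogram, and the scalar product and cross product of its sides are those of the cell. -/
theorem parallelogram_of_dist {A B E D : Plane} {p q : ℝ}
    (hAB : dist A B = √(1 + p ^ 2)) (hAD : dist A D = √(1 + q ^ 2))
    (hAE : dist A E = √(1 + 1 + (p + q) ^ 2)) (hBE : dist B E = √(1 + q ^ 2))
    (hDE : dist D E = √(1 + p ^ 2)) (hBD : dist B D = √(1 + 1 + (q - p) ^ 2))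
    (hpos : 0 < Cap.cross A B D) :
    (∀ i, E i - D i = B i - A i) ∧
    (B 0 - A 0) ^ 2 + (B 1 - A 1) ^ 2 = 1 + p ^ 2 ∧
    (D 0 - A 0) ^ 2 + (D 1 - A 1) ^ 2 = 1 + q ^ 2 ∧
    (B 0 - A 0) * (D 0 - A 0) + (B 1 - A 1) * (D 1 - A 1) = p * q ∧
    Cap.cross A B D = √(1 + p ^ 2 + q ^ 2) := by
  simp only [EuclideanSpace.dist_eq, Fin.sum_univ_two, Real.dist_eq, sq_abs] at *
  rw [Real.sqrt_inj (by positivity) (by positivity)] at hAB hAD hAE hBE hDE hBD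
  have hdot : (B 0 - A 0) * (D 0 - A 0) + (B 1 - A 1) * (D 1 - A 1) = p * q := by
    linear_combination (hAB + hAD - hBD) / 2
  have hsum : (E 0 - D 0 - (B 0 - A 0)) ^ 2 + (E 1 - D 1 - (B 1 - A 1)) ^ 2 = 0 := by
    linear_combination hAB + hAD + hBE + hDE - hAE - hBD
  refine ⟨?_, by linear_combination hAB, by linear_combination hAD, hdot, ?_⟩
  · have h := (add_eq_zero_iff_of_nonneg (sq_nonneg _) (sq_nonneg _)).1 hsum
    have h0 := pow_eq_zero_iff two_ne_zero |>.1 h.1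
    have h1 := pow_eq_zero_iff two_ne_zero |>.1 h.2
    intro i
    fin_cases i
    · exact sub_eq_zero.1 h0
    · exact sub_eq_zero.1 h1
  · rw [eq_comm, Real.sqrt_eq_iff_mul_self_eq (by positivity) hpos.le, Cap.cross]
    have h1 : (B 0 - A 0) ^ 2 + (B 1 - A 1) ^ 2 = 1 + p ^ 2 := by linear_combination hAB
    have h2 : (D 0 - A 0) ^ 2 + (D 1 - A 1) ^ 2 = 1 + q ^ 2 := by linear_combination hAD
    -- Lagrange's identity
    have : ((B 0 - A 0) * (D 1 - A 1) - (B 1 - A 1) * (D 0 - A 0)) ^ 2 =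
        (1 + p ^ 2) * (1 + q ^ 2) - (p * q) ^ 2 := by
      rw [← h1, ← h2, ← hdot]; ring
    linear_combination -this

/-- The side `v` of a parallelogram cell, if the side `u` has direction `ω + edgeAngle q p`. -/
theorem side_eq_of_side_eq {p q u0 u1 v0 v1 ω : ℝ}
    (h0 : u0 = √(1 + p ^ 2) * Real.cos (ω + edgeAngle q p))
    (h1 : u1 = √(1 + p ^ 2) * Real.sin (ω + edgeAngle q p))
    (hdot : u0 * v0 + u1 * v1 = p * q) (hcross : u0 * v1 - u1 * v0 = √(1 + p ^ 2 + q ^ 2)) :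
    v0 = -(√(1 + q ^ 2) * Real.sin ω) ∧ v1 = √(1 + q ^ 2) * Real.cos ω := by
  have hc := sqrt_mul_cos_edgeAngle q p
  have hs := sqrt_mul_sin_edgeAngle q p
  have hl : √(1 + p ^ 2) ≠ 0 := by positivity
  rw [Real.cos_add] at h0
  rw [Real.sin_add] at h1
  rw [← hc] at hcross
  rw [← hs] at hdot
  have hψ := Real.sin_sq_add_cos_sq (edgeAngle q p)
  have hω := Real.sin_sq_add_cos_sq ω
  generalize edgeAngle q p = ψ at *
  generalize √(1 + p ^ 2) = l at *
  generalize √(1 + q ^ 2) = r at *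
  have hn : u0 ^ 2 + u1 ^ 2 = l ^ 2 := by
    rw [h0, h1]
    linear_combination l ^ 2 * (Real.sin ω ^ 2 + Real.cos ω ^ 2) * hψ + l ^ 2 * hω
  have e0 : l ^ 2 * v0 = l * (Real.sin ψ * u0 - Real.cos ψ * u1) * r := by
    linear_combination -v0 * hn + u0 * hdot - u1 * hcross
  have e1 : l ^ 2 * v1 = l * (Real.sin ψ * u1 + Real.cos ψ * u0) * r := by
    linear_combination -v1 * hn + u1 * hdot + u0 * hcross
  constructor
  · refine mul_left_cancel₀ (pow_ne_zero 2 hl) ?_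
    rw [e0, h0, h1]
    linear_combination -l ^ 2 * r * Real.sin ω * hψ
  · refine mul_left_cancel₀ (pow_ne_zero 2 hl) ?_
    rw [e1, h0, h1]
    linear_combination l ^ 2 * r * Real.cos ω * hψ

/-- The side `u` of a parallelogram cell, if the side `v` is the left normal of direction `ω`. -/
theorem side_eq_of_left_side_eq {p q u0 u1 v0 v1 ω : ℝ}
    (h0 : v0 = -(√(1 + q ^ 2) * Real.sin ω)) (h1 : v1 = √(1 + q ^ 2) * Real.cos ω)
    (hdot : u0 * v0 + u1 * v1 = p * q) (hcross : u0 * v1 - u1 * v0 = √(1 + p ^ 2 + q ^ 2)) :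
    u0 = √(1 + p ^ 2) * Real.cos (ω + edgeAngle q p) ∧
      u1 = √(1 + p ^ 2) * Real.sin (ω + edgeAngle q p) := by
  have hc := sqrt_mul_cos_edgeAngle q p
  have hs := sqrt_mul_sin_edgeAngle q p
  have hr : √(1 + q ^ 2) ≠ 0 := by positivity
  rw [Real.cos_add, Real.sin_add]
  rw [← hc] at hcross
  rw [← hs] at hdot
  have hω := Real.sin_sq_add_cos_sq ω
  generalize edgeAngle q p = ψ at *
  generalize √(1 + p ^ 2) = l at *
  generalize √(1 + q ^ 2) = r at *
  subst h0 h1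
  constructor
  · refine mul_left_cancel₀ hr ?_
    linear_combination -r * u0 * hω - Real.sin ω * hdot + Real.cos ω * hcross
  · refine mul_left_cancel₀ hr ?_
    linear_combination -r * u1 * hω + Real.cos ω * hdot + Real.sin ω * hcross

theorem exists_polar {u v l : ℝ} (hl : 0 ≤ l) (h : u ^ 2 + v ^ 2 = l ^ 2) :
    ∃ Ω, u = l * Real.cos Ω ∧ v = l * Real.sin Ω := by
  have hn : ‖(⟨u, v⟩ : ℂ)‖ = l := by
    rw [Complex.norm_def, Complex.normSq_mk, ← Real.sqrt_sq hl, ← h]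
    congr 1
    ring
  refine ⟨Complex.arg ⟨u, v⟩, ?_, ?_⟩
  · rw [← hn, Complex.norm_mul_cos_arg]
  · rw [← hn, Complex.norm_mul_sin_arg]

/-! ### Planar chains given by lengths and directions -/

/-- The first `N` edges of the planar chain `c 0, c 1, …` have the lengths `l` and the
directions `A`. -/
def HasEdges (N : ℕ) (c : ℕ → Plane) (l A : ℕ → ℝ) : Prop :=
  ∀ m, m < N → c (m + 1) 0 - c m 0 = l m * Real.cos (A m) ∧
    c (m + 1) 1 - c m 1 = l m * Real.sin (A m)

theorem HasEdges.sub_zero {N : ℕ} {c : ℕ → Plane} {l A : ℕ → ℝ} (h : HasEdges N c l A) {j k : ℕ}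
    (hjk : j ≤ k) (hk : k ≤ N) :
    c k 0 - c j 0 = ∑ m ∈ Finset.Ico j k, l m * Real.cos (A m) := by
  rw [← Finset.sum_Ico_sub (fun m => c m 0) hjk]
  exact Finset.sum_congr rfl fun m hm => (h m (by have := Finset.mem_Ico.1 hm; omega)).1

theorem HasEdges.sub_one {N : ℕ} {c : ℕ → Plane} {l A : ℕ → ℝ} (h : HasEdges N c l A) {j k : ℕ}
    (hjk : j ≤ k) (hk : k ≤ N) :
    c k 1 - c j 1 = ∑ m ∈ Finset.Ico j k, l m * Real.sin (A m) := by
  rw [← Finset.sum_Ico_sub (fun m => c m 1) hjk]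
  exact Finset.sum_congr rfl fun m hm => (h m (by have := Finset.mem_Ico.1 hm; omega)).2

theorem HasEdges.cross_eq {N : ℕ} {c : ℕ → Plane} {l A : ℕ → ℝ} (h : HasEdges N c l A) {i : ℕ}
    (hi : i < N) (X : Plane) : Cap.cross (c i) (c (i + 1)) X =
      l i * (Real.cos (A i) * (X 1 - c i 1) - Real.sin (A i) * (X 0 - c i 0)) := by
  rw [Cap.cross, (h i hi).1, (h i hi).2]
  ring

/-- The position of a vertex of one chain relative to the line through an edge of another chain
with the same first vertex. -/
theorem HasEdges.cross_eq_sum {N : ℕ} {c d : ℕ → Plane} {l A B : ℕ → ℝ} (h : HasEdges N c l A)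
    (h' : HasEdges N d l B) (h0 : c 0 = d 0) {i k : ℕ} (hi : i < N) (hk : k ≤ N) :
    Cap.cross (c i) (c (i + 1)) (d k) =
      l i * (∑ j ∈ Finset.range k, l j * Real.sin (B j - A i) -
        ∑ j ∈ Finset.range i, l j * Real.sin (A j - A i)) := by
  have e0 := h'.sub_zero (Nat.zero_le k) hk
  have e1 := h'.sub_one (Nat.zero_le k) hk
  have f0 := h.sub_zero (Nat.zero_le i) hi.le
  have f1 := h.sub_one (Nat.zero_le i) hi.le
  rw [h.cross_eq hi]
  congr 1
  simp only [Real.sin_sub, mul_sub, Finset.sum_sub_distrib, ← mul_assoc, ← Finset.sum_mul]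
  rw [Finset.range_eq_Ico, Finset.range_eq_Ico, ← e0, ← e1, ← f0, ← f1, h0]
  ring

theorem RadiallyMonotoneChain.inner_nonneg {n : ℕ} {c : ℕ → Plane}
    (h : RadiallyMonotoneChain n c) {j i : ℕ} (hj : 1 ≤ j) (hji : j < i) (hi : i + 1 ≤ n) :
    0 ≤ (c i 0 - c j 0) * (c (i + 1) 0 - c i 0) + (c i 1 - c j 1) * (c (i + 1) 1 - c i 1) := by
  have h1 := h j i hj hji hi
  rw [EuclideanGeometry.angle] at h1
  have h2 := Real.cos_nonpos_of_pi_div_two_le_of_le h1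
    (by linarith [InnerProductGeometry.angle_le_pi (c j -ᵥ c i) (c (i + 1) -ᵥ c i), Real.pi_pos])
  have h3 := InnerProductGeometry.cos_angle_mul_norm_mul_norm (c j -ᵥ c i) (c (i + 1) -ᵥ c i)
  have h4 : inner ℝ (c j -ᵥ c i) (c (i + 1) -ᵥ c i) ≤ 0 := by
    rw [← h3]
    exact mul_nonpos_of_nonpos_of_nonneg h2 (by positivity)
  simp [PiLp.inner_apply, Fin.sum_univ_two] at h4
  linarith

/-- Radial monotonicity in terms of lengths and directions: the component along the edge `i` of the
chord from the vertex `j` to the start of that edge is nonnegative. The chain has `N` edges and its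
vertices are `c 1, …, c (N + 1)`. -/
theorem HasEdges.sum_cos_nonneg {N : ℕ} {c : ℕ → Plane} {l A : ℕ → ℝ}
    (h : HasEdges N (fun m => c (m + 1)) l A) (hl : ∀ m, 0 < l m)
    (hc : RadiallyMonotoneChain (N + 1) c) (j i : ℕ) (hji : j < i) (hi : i < N) :
    0 ≤ ∑ m ∈ Finset.Ico j i, l m * Real.cos (A i - A m) := by
  have h1 := hc.inner_nonneg (j := j + 1) (i := i + 1) (by omega) (by omega) (by omega)
  have e0 := h.sub_zero hji.le hi.le
  have e1 := h.sub_one hji.le hi.le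
  simp only at e0 e1
  rw [(h i hi).1, (h i hi).2, e0, e1] at h1
  refine nonneg_of_mul_nonneg_right (b := ∑ m ∈ Finset.Ico j i, l m * Real.cos (A i - A m)) ?_
    (hl i)
  refine h1.trans_eq ?_
  simp only [Real.cos_sub, Finset.mul_sum, Finset.sum_mul, ← Finset.sum_add_distrib]
  refine Finset.sum_congr rfl fun m _ => ?_
  ring

theorem HasEdges.ne {N : ℕ} {c : ℕ → Plane} {l A : ℕ → ℝ} (h : HasEdges N c l A)
    (hl : ∀ m, 0 < l m) {m : ℕ} (hm : m < N) : c m ≠ c (m + 1) := by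
  intro he
  obtain ⟨h0, h1⟩ := h m hm
  rw [he, sub_self, eq_comm, mul_eq_zero] at h0 h1
  have hc := h0.resolve_left (hl m).ne'
  have hs := h1.resolve_left (hl m).ne'
  have := Real.sin_sq_add_cos_sq (A m)
  simp [hc, hs] at this

/-- An edge that encloses an angle of at most `π / 2` with the direction `ω` has a nonnegative
component along it. -/
theorem HasEdges.component_nonneg {N : ℕ} {c : ℕ → Plane} {l A : ℕ → ℝ}
    (h : HasEdges N c l A) (hl : ∀ m, 0 < l m) {m : ℕ} (hm : m < N) {ω : ℝ}
    (h1 : -(Real.pi / 2) ≤ A m - ω) (h2 : A m - ω ≤ Real.pi / 2) :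
    0 ≤ (c (m + 1) 0 - c m 0) * Real.cos ω + (c (m + 1) 1 - c m 1) * Real.sin ω := by
  have := mul_nonneg (hl m).le (Real.cos_nonneg_of_neg_pi_div_two_le_of_le h1 h2)
  rw [Real.cos_sub] at this
  rw [(h m hm).1, (h m hm).2]
  linarith

/-- Two chains with the same first edge whose edges `j` have the directions
`ω + edgeAngle q (p j)` and `η + edgeAngle r (p j)`, where `0 ≤ r ≤ q` and `p` decreases, turn to
the right. The chain `c` for `q` lies to the right of the line through each edge of the chain `d` for
`r`, provided that `d` is radially monotone. -/
theorem cross_nonpos_of_nonneg_slope {N : ℕ} {c d : ℕ → Plane} {l p : ℕ → ℝ} {q r ω η : ℝ}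
    (hl : ∀ m, 0 < l m) (hp : ∀ i j, i ≤ j → j < N → p j ≤ p i) (hr : 0 ≤ r) (hrq : r ≤ q)
    (hc : HasEdges N (fun m => c (m + 1)) l fun m => ω + edgeAngle q (p m))
    (hd : HasEdges N (fun m => d (m + 1)) l fun m => η + edgeAngle r (p m))
    (hωη : ω + edgeAngle q (p 0) = η + edgeAngle r (p 0)) (h0 : c 1 = d 1)
    (hrad : RadiallyMonotoneChain (N + 1) d) {i k : ℕ} (hi : i < N) (hk : k ≤ N) :
    Cap.cross (d (i + 1)) (d (i + 1 + 1)) (c (k + 1)) ≤ 0 := by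
  have h := sum_sin_le_sum_sin l (fun m => -(ω + edgeAngle q (p m)))
    (fun m => -(η + edgeAngle r (p m))) N (fun m => (hl m).le)
    (fun i j hij hj => by
      linarith [monotone_edgeAngle (hr.trans hrq) (hp i j hij hj)])
    (fun i j hij hj => by linarith [monotone_edgeAngle hr (hp i j hij hj)])
    (fun i j hij hj => by
      have := monotone_edgeAngle_sub hr hrq (hp i j hij hj)
      simp only at this
      linarith)
    (by linarith)
    (fun j _ => by linarith [(edgeAngle_mem q (p j)).1, (edgeAngle_mem q (p 0)).2])
    (fun j i hji hi => by
      convert hd.sum_cos_nonneg hl hrad j i hji hi using 3 with m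
      rw [← Real.cos_neg]
      congr 1
      ring) i k hi hk
  rw [hd.cross_eq_sum hc h0.symm hi hk]
  refine mul_nonpos_of_nonneg_of_nonpos (hl i).le (sub_nonpos.2 ?_)
  have e : ∀ u v : ℝ, -u - -v = v - u := fun u v => by ring
  simpa only [e] using h

/-- The mirror image of `cross_nonpos_of_nonneg_slope`, where both chains turn to the left. Now `d`
turns further than `c`, so that the lines are those through the edges of `c`. -/
theorem cross_nonneg_of_nonpos_slope {N : ℕ} {c d : ℕ → Plane} {l p : ℕ → ℝ} {q r ω η : ℝ}
    (hl : ∀ m, 0 < l m) (hp : ∀ i j, i ≤ j → j < N → p j ≤ p i) (hq : q ≤ 0) (hrq : r ≤ q)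
    (hc : HasEdges N (fun m => c (m + 1)) l fun m => ω + edgeAngle q (p m))
    (hd : HasEdges N (fun m => d (m + 1)) l fun m => η + edgeAngle r (p m))
    (hωη : ω + edgeAngle q (p 0) = η + edgeAngle r (p 0)) (h0 : c 1 = d 1)
    (hrad : RadiallyMonotoneChain (N + 1) c) {i k : ℕ} (hi : i < N) (hk : k ≤ N) :
    0 ≤ Cap.cross (c (i + 1)) (c (i + 1 + 1)) (d (k + 1)) := by
  have h := sum_sin_le_sum_sin l (fun m => η + edgeAngle r (p m))
    (fun m => ω + edgeAngle q (p m)) N (fun m => (hl m).le)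
    (fun i j hij hj => by
      linarith [edgeAngle_antitone_of_nonpos (hrq.trans hq) (hp i j hij hj)])
    (fun i j hij hj => by linarith [edgeAngle_antitone_of_nonpos hq (hp i j hij hj)])
    (fun i j hij hj => by
      have := monotone_edgeAngle_sub_of_nonpos hq hrq (hp i j hij hj)
      simp only at this
      linarith)
    hωη.symm
    (fun j _ => by linarith [(edgeAngle_mem r (p j)).2, (edgeAngle_mem r (p 0)).1])
    (fun j i hji hi => hc.sum_cos_nonneg hl hrad j i hji hi) i k hi hk
  rw [hc.cross_eq_sum hd h0 hi hk]
  refine mul_nonneg (hl i).le (sub_nonneg.2 ?_)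
  have hneg : ∀ (n : ℕ) (f g : ℕ → ℝ), ∑ j ∈ Finset.range n, l j * Real.sin (f j - g j) =
      -∑ j ∈ Finset.range n, l j * Real.sin (g j - f j) := by
    intro n f g
    rw [← Finset.sum_neg_distrib]
    refine Finset.sum_congr rfl fun j _ => ?_
    rw [← neg_sub (g j), Real.sin_neg, mul_neg]
  rw [hneg _ (fun j => ω + edgeAngle q (p j)) (fun _ => ω + edgeAngle q (p i)),
    hneg _ (fun j => η + edgeAngle r (p j)) (fun _ => ω + edgeAngle q (p i))]
  linarith

/-! ### Separation by lines -/

theorem cross_swap (A B X : Plane) : Cap.cross B A X = -Cap.cross A B X := by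
  simp only [Cap.cross]
  ring

theorem convex_setOf_cross_nonpos (A B : Plane) : Convex ℝ {X | Cap.cross A B X ≤ 0} := by
  intro X hX Y hY a b ha hb hab
  simp only [Set.mem_ofPred_eq, Cap.cross, PiLp.add_apply, PiLp.smul_apply, smul_eq_mul] at *
  obtain rfl : b = 1 - a := by linarith
  nlinarith [mul_nonneg ha (neg_nonneg.2 hX), mul_nonneg hb (neg_nonneg.2 hY)]

/-- An interior point of a region to the right of a line lies strictly to the right of it. -/
theorem cross_neg_of_mem_interior {A B : Plane} (hAB : A ≠ B) {U : Set Plane}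
    (hU : ∀ X ∈ U, Cap.cross A B X ≤ 0) {X : Plane} (hX : X ∈ interior U) :
    Cap.cross A B X < 0 := by
  refine lt_of_le_of_ne (hU X (interior_subset hX)) fun h0 => ?_
  -- the left normal of the line
  set n : Plane := !₂[-(B 1 - A 1), B 0 - A 0] with hn
  have hcont : Filter.Tendsto (fun t : ℝ => X + t • n) (nhdsWithin 0 (Set.Ioi 0)) (nhds X) := by
    have : Continuous fun t : ℝ => X + t • n := by fun_prop
    simpa using (this.tendsto 0).mono_left nhdsWithin_le_nhds
  obtain ⟨t, ht, ht0⟩ := ((hcont.eventually (mem_interior_iff_mem_nhds.1 hX)).and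
    self_mem_nhdsWithin).exists
  have h1 := hU _ ht
  have h2 : Cap.cross A B (X + t • n) =
      Cap.cross A B X + t * ((B 0 - A 0) ^ 2 + (B 1 - A 1) ^ 2) := by
    simp [Cap.cross, hn]
    ring
  rw [h2, h0, zero_add] at h1
  have h3 : (B 0 - A 0) ^ 2 + (B 1 - A 1) ^ 2 ≤ 0 := nonpos_of_mul_nonpos_right h1 ht0
  refine hAB ?_
  ext i
  fin_cases i
  · change A 0 = B 0
    nlinarith [sq_nonneg (B 1 - A 1), sq_nonneg (B 0 - A 0)]
  · change A 1 = B 1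
    nlinarith [sq_nonneg (B 1 - A 1), sq_nonneg (B 0 - A 0)]

/-- Two regions have disjoint interiors if one is covered by pieces each of which is separated
by a line from the whole of the other. -/
theorem disjoint_interior_of_cross {U V : Set Plane}
    (h : ∀ X ∈ V, ∃ A B : Plane, A ≠ B ∧ 0 ≤ Cap.cross A B X ∧ ∀ Y ∈ U, Cap.cross A B Y ≤ 0) :
    Disjoint (interior U) (interior V) := by
  rw [Set.disjoint_left]
  intro X hXU hXV
  obtain ⟨A, B, hAB, hX, hU⟩ := h X (interior_subset hXV)
  exact absurd (cross_neg_of_mem_interior hAB hU hXU) (not_lt.2 hX)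

/-- A quadrilateral of the strip lies on one side of a line if its corners do. -/
theorem cross_nonpos_of_corners {x y : ℕ} {P : ℕ × ℕ → Plane} {A B : Plane}
    (h1 : Cap.cross A B (P (x, y)) ≤ 0) (h2 : Cap.cross A B (P (x + 1, y)) ≤ 0)
    (h3 : Cap.cross A B (P (x, y + 1)) ≤ 0) (h4 : Cap.cross A B (P (x + 1, y + 1)) ≤ 0)
    {X : Plane} (hX : X ∈ convexHull ℝ (Set.range fun i => P (corner x y i))) :
    Cap.cross A B X ≤ 0 := by
  refine convexHull_min ?_ (convex_setOf_cross_nonpos A B) hX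
  rintro _ ⟨i, rfl⟩
  fin_cases i
  exacts [h1, h2, h4, h3]

/-! ### Unfolded strips -/

/-- The relations between the sides of an unfolded cell, in terms of the slopes of the cap. -/
theorem Cap.IsStripUnfolding.cell {C : Cap} {y : ℕ} {P : ℕ × ℕ → Plane}
    (hP : C.IsStripUnfolding y P) (hy : 1 ≤ y) (hy' : y < C.ny) {x : ℕ} (hx : 1 ≤ x)
    (hx' : x < C.nx) :
    (∀ i, P (x + 1, y + 1) i - P (x, y + 1) i = P (x + 1, y) i - P (x, y) i) ∧
    (P (x + 1, y) 0 - P (x, y) 0) * (P (x, y + 1) 0 - P (x, y) 0) +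
      (P (x + 1, y) 1 - P (x, y) 1) * (P (x, y + 1) 1 - P (x, y) 1) =
        C.slopeX x * C.slopeY y ∧
    (P (x + 1, y) 0 - P (x, y) 0) * (P (x, y + 1) 1 - P (x, y) 1) -
      (P (x + 1, y) 1 - P (x, y) 1) * (P (x, y + 1) 0 - P (x, y) 0) =
        √(1 + C.slopeX x ^ 2 + C.slopeY y ^ 2) ∧
    (P (x + 1, y) 0 - P (x, y) 0) ^ 2 + (P (x + 1, y) 1 - P (x, y) 1) ^ 2 =
      1 + C.slopeX x ^ 2 := by
  obtain ⟨hd, hpos⟩ := hP x hx hx'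
  have s1 := C.z_sub_z_eq_slopeX hx hx' hy hy'.le
  have s2 := C.z_sub_z_eq_slopeX hx hx' (by omega : 1 ≤ y + 1) hy'
  have s3 := C.z_sub_z_eq_slopeY hx hx'.le hy hy'
  have s4 := C.z_sub_z_eq_slopeY (by omega : 1 ≤ x + 1) hx' hy hy'
  have key : ∀ u v : ℕ × ℕ, dist (C.vertex u) (C.vertex v) =
      √(((u.1 : ℝ) - v.1) ^ 2 + ((u.2 : ℝ) - v.2) ^ 2 + (C.z u - C.z v) ^ 2) := by
    intro u v
    simp [EuclideanSpace.dist_eq, Fin.sum_univ_three, Real.dist_eq, vertex, lift]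
  have h01 : dist (P (x, y)) (P (x + 1, y)) = √(1 + C.slopeX x ^ 2) :=
    (hd 0 1).trans (by rw [key]; congr 1; simp [corner, ← s1]; ring)
  have h03 : dist (P (x, y)) (P (x, y + 1)) = √(1 + C.slopeY y ^ 2) :=
    (hd 0 3).trans (by rw [key]; congr 1; simp [corner, ← s3]; ring)
  have h02 : dist (P (x, y)) (P (x + 1, y + 1)) =
      √(1 + 1 + (C.slopeX x + C.slopeY y) ^ 2) :=
    (hd 0 2).trans (by rw [key]; congr 1; simp [corner, ← s1, ← s4]; ring)
  have h12 : dist (P (x + 1, y)) (P (x + 1, y + 1)) = √(1 + C.slopeY y ^ 2) :=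
    (hd 1 2).trans (by rw [key]; congr 1; simp [corner, ← s4]; ring)
  have h32 : dist (P (x, y + 1)) (P (x + 1, y + 1)) = √(1 + C.slopeX x ^ 2) :=
    (hd 3 2).trans (by rw [key]; congr 1; simp [corner, ← s2]; ring)
  have h13 : dist (P (x + 1, y)) (P (x, y + 1)) = √(1 + 1 + (C.slopeY y - C.slopeX x) ^ 2) :=
    (hd 1 3).trans (by rw [key]; congr 1; simp [corner, ← s1, ← s3]; ring)
  obtain ⟨r1, r2, -, r4, r5⟩ := parallelogram_of_dist h01 h03 h02 h12 h32 h13 hpos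
  exact ⟨r1, r4, r5, r2⟩

/-- The unfolding of a strip whose first edge in the `x`-direction has direction `Ω`: all edges in
the `y`-direction are translates of one vector, and the edges of both boundary chains enclose the
angles `edgeAngle` with its right normal. -/
theorem Cap.IsStripUnfolding.polar {C : Cap} {y : ℕ} {P : ℕ × ℕ → Plane}
    (hP : C.IsStripUnfolding y P) (hy : 1 ≤ y) (hy' : y < C.ny) {Ω ω : ℝ}
    (hω : Ω = ω + edgeAngle (C.slopeY y) (C.slopeX 1))
    (h0 : P (2, y) 0 - P (1, y) 0 = √(1 + C.slopeX 1 ^ 2) * Real.cos Ω)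
    (h1 : P (2, y) 1 - P (1, y) 1 = √(1 + C.slopeX 1 ^ 2) * Real.sin Ω) :
    (∀ x, 1 ≤ x → x ≤ C.nx →
      P (x, y + 1) 0 - P (x, y) 0 = -(√(1 + C.slopeY y ^ 2) * Real.sin ω) ∧
      P (x, y + 1) 1 - P (x, y) 1 = √(1 + C.slopeY y ^ 2) * Real.cos ω) ∧
    HasEdges (C.nx - 1) (fun m => P (m + 1, y)) (fun m => √(1 + C.slopeX (m + 1) ^ 2))
      (fun m => ω + edgeAngle (C.slopeY y) (C.slopeX (m + 1))) ∧
    HasEdges (C.nx - 1) (fun m => P (m + 1, y + 1)) (fun m => √(1 + C.slopeX (m + 1) ^ 2))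
      (fun m => ω + edgeAngle (C.slopeY y) (C.slopeX (m + 1))) := by
  have hnx := C.two_le_nx
  have hβ : ∀ x, 1 ≤ x → x ≤ C.nx →
      P (x, y + 1) 0 - P (x, y) 0 = -(√(1 + C.slopeY y ^ 2) * Real.sin ω) ∧
      P (x, y + 1) 1 - P (x, y) 1 = √(1 + C.slopeY y ^ 2) * Real.cos ω := by
    intro x hx
    induction x, hx using Nat.le_induction with
    | base =>
      intro _
      obtain ⟨-, hdot, hcross, -⟩ := hP.cell hy hy' le_rfl (by omega)
      exact side_eq_of_side_eq (hω ▸ h0) (hω ▸ h1) hdot hcross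
    | succ x hx ih =>
      intro hx'
      obtain ⟨hpar, -⟩ := hP.cell hy hy' hx (by omega)
      obtain ⟨i0, i1⟩ := ih (by omega)
      constructor
      · linear_combination hpar 0 + i0
      · linear_combination hpar 1 + i1
  have hE : HasEdges (C.nx - 1) (fun m => P (m + 1, y)) (fun m => √(1 + C.slopeX (m + 1) ^ 2))
      (fun m => ω + edgeAngle (C.slopeY y) (C.slopeX (m + 1))) := by
    intro m hm
    obtain ⟨-, hdot, hcross, -⟩ := hP.cell hy hy' (by omega : 1 ≤ m + 1) (by omega)
    obtain ⟨b0, b1⟩ := hβ (m + 1) (by omega) (by omega)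
    exact side_eq_of_left_side_eq b0 b1 hdot hcross
  refine ⟨hβ, hE, fun m hm => ?_⟩
  obtain ⟨hpar, -⟩ := hP.cell hy hy' (by omega : 1 ≤ m + 1) (by omega)
  exact ⟨(hpar 0).trans (hE m hm).1, (hpar 1).trans (hE m hm).2⟩

theorem Cap.cross_nonpos_of_mem_stripRegion {C : Cap} {y : ℕ} {P : ℕ × ℕ → Plane} {A B : Plane}
    (h : ∀ x, 1 ≤ x → x ≤ C.nx → Cap.cross A B (P (x, y)) ≤ 0 ∧ Cap.cross A B (P (x, y + 1)) ≤ 0)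
    {X : Plane} (hX : X ∈ C.stripRegion y P) : Cap.cross A B X ≤ 0 := by
  obtain ⟨x, hx, hx', hX⟩ := hX
  exact cross_nonpos_of_corners (h x hx hx'.le).1 (h (x + 1) (by omega) (by omega)).1
    (h x hx hx'.le).2 (h (x + 1) (by omega) (by omega)).2 hX

end QuadCap

open QuadCap QuadCap.Cap in
theorem mainTheorem2 (C : QuadCap.Cap) (hconv : C.IsConvex) (hrad : C.IsRadiallyMonotone)
    (P : ℕ → ℕ × ℕ → QuadCap.Plane) (hP : C.IsUnfolding P)
    (y : ℕ) (hy : 1 ≤ y) (hy' : y + 1 < C.ny) :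
    Disjoint (interior (C.stripRegion y (P y)))
      (interior (C.stripRegion (y + 1) (P (y + 1)))) := by
  have hnx := C.two_le_nx
  obtain ⟨hS, hglue⟩ := hP
  obtain ⟨hg1, hg2⟩ := hglue y hy hy'
  have hS1 := hS y hy (by omega)
  have hS2 := hS (y + 1) (by omega) hy'
  have hN : C.nx - 1 + 1 = C.nx := by omega
  have hrad1 := (hrad y hy (by omega) _ hS1).2
  have hrad2 := (hrad (y + 1) (by omega) hy' _ hS2).1
  rw [← hN] at hrad1 hrad2
  -- the direction of the common edge
  obtain ⟨-, -, -, hlen⟩ := hS2.cell (by omega) hy' le_rfl (by omega : 1 < C.nx)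
  obtain ⟨Ω, hΩ0, hΩ1⟩ := exists_polar (Real.sqrt_nonneg (1 + C.slopeX 1 ^ 2))
    (hlen.trans (Real.sq_sqrt (by positivity)).symm)
  obtain ⟨hpar, -⟩ := hS1.cell hy (by omega) le_rfl (by omega : 1 < C.nx)
  have hq := hconv.slopeY_succ_le hy hy'
  have hp : ∀ i j, i ≤ j → j < C.nx - 1 → C.slopeX (j + 1) ≤ C.slopeX (i + 1) :=
    fun i j hij hj => hconv.slopeX_le (by omega) (by omega) (by omega)
  obtain ⟨hβ, -, hc⟩ := hS1.polar hy (by omega) (Ω := Ω)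
    (ω := Ω - edgeAngle (C.slopeY y) (C.slopeX 1)) (by ring)
    ((hpar 0).symm.trans (by rw [hg1, hg2]; exact hΩ0))
    ((hpar 1).symm.trans (by rw [hg1, hg2]; exact hΩ1))
  obtain ⟨hγ, hd, -⟩ := hS2.polar (by omega) hy' (Ω := Ω)
    (ω := Ω - edgeAngle (C.slopeY (y + 1)) (C.slopeX 1)) (by ring) hΩ0 hΩ1
  set q := C.slopeY y
  set r := C.slopeY (y + 1)
  have hl : ∀ m, 0 < √(1 + C.slopeX (m + 1) ^ 2) := fun m => by positivity
  have hq' : 0 < √(1 + q ^ 2) := by positivity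
  have hr' : 0 < √(1 + r ^ 2) := by positivity
  -- The other boundary chain of each strip is a translate of the common one; the added term is the
  -- length of the translation vector times the component of `B - A` along its right normal.
  have hcx : ∀ x, 1 ≤ x → x ≤ C.nx → ∀ A B : Plane,
      Cap.cross A B (P y (x, y)) = Cap.cross A B (P y (x, y + 1)) -
        √(1 + q ^ 2) * ((B 0 - A 0) * Real.cos (Ω - edgeAngle q (C.slopeX 1)) +
          (B 1 - A 1) * Real.sin (Ω - edgeAngle q (C.slopeX 1))) := by
    intro x hx hx' A B
    obtain ⟨b0, b1⟩ := hβ x hx hx'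
    rw [Cap.cross, Cap.cross]
    linear_combination (B 1 - A 1) * b0 - (B 0 - A 0) * b1
  have hdx : ∀ x, 1 ≤ x → x ≤ C.nx → ∀ A B : Plane,
      Cap.cross A B (P (y + 1) (x, y + 1 + 1)) = Cap.cross A B (P (y + 1) (x, y + 1)) +
        √(1 + r ^ 2) * ((B 0 - A 0) * Real.cos (Ω - edgeAngle r (C.slopeX 1)) +
          (B 1 - A 1) * Real.sin (Ω - edgeAngle r (C.slopeX 1))) := by
    intro x hx hx' A B
    obtain ⟨b0, b1⟩ := hγ x hx hx'
    rw [Cap.cross, Cap.cross]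
    linear_combination (B 0 - A 0) * b1 - (B 1 - A 1) * b0
  have hAA : ∀ A B : Plane, Cap.cross A B A = 0 := fun A B => by simp [Cap.cross]
  have hBB : ∀ A B : Plane, Cap.cross A B B = 0 := fun A B => by simp only [Cap.cross]; ring
  rcases le_total 0 r with hr | hr
  · -- Both chains turn to the right: each cell of the upper strip lies to the left of its edge on
    -- the common boundary, and the lower strip to the right.
    refine disjoint_interior_of_cross fun X hX => ?_
    obtain ⟨x, hx, hx', hX⟩ := hX
    obtain ⟨i, rfl⟩ : ∃ i, x = i + 1 := ⟨x - 1, by omega⟩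
    have hi : i < C.nx - 1 := by omega
    have hi0 := hp 0 i (Nat.zero_le _) hi
    have m1 := monotone_edgeAngle hr hi0
    have m2 := monotone_edgeAngle_sub hr hq hi0
    simp only [zero_add] at m1 m2
    refine ⟨P (y + 1) (i + 1, y + 1), P (y + 1) (i + 1 + 1, y + 1), hd.ne hl hi, ?_, ?_⟩
    · have hw := hd.component_nonneg hl hi (ω := Ω - edgeAngle r (C.slopeX 1))
        (by linarith [(edgeAngle_mem r (C.slopeX (i + 1))).1])
        (by linarith [(edgeAngle_mem r (C.slopeX (i + 1))).2])
      have hw' := mul_nonneg hr'.le hw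
      rw [← neg_nonpos, ← cross_swap]
      refine cross_nonpos_of_corners ?_ ?_ ?_ ?_ hX <;> rw [cross_swap, neg_nonpos]
      · rw [hAA]
      · rw [hBB]
      · rw [hdx _ (by omega) (by omega), hAA]; linarith
      · rw [hdx _ (by omega) (by omega), hBB]; linarith
    · intro Y hY
      have hw := hd.component_nonneg hl hi (ω := Ω - edgeAngle q (C.slopeX 1))
        (by linarith [(edgeAngle_mem q (C.slopeX (i + 1))).1])
        (by linarith [(edgeAngle_mem q (C.slopeX 1)).2])
      have hw' := mul_nonneg hq'.le hw
      refine cross_nonpos_of_mem_stripRegion (C := C) (fun x hx hx' => ?_) hY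
      obtain ⟨k, rfl⟩ : ∃ k, x = k + 1 := ⟨x - 1, by omega⟩
      have h := cross_nonpos_of_nonneg_slope (c := fun m => P y (m, y + 1))
        (d := fun m => P (y + 1) (m, y + 1)) (k := k) hl hp hr hq hc hd (by simp) hg1 hrad2 hi
        (by omega)
      refine ⟨?_, h⟩
      rw [hcx _ hx hx']
      linarith
  rcases le_total q 0 with hq0 | hq0
  · -- Both chains turn to the left: the roles of the strips are exchanged.
    refine (disjoint_interior_of_cross fun X hX => ?_).symm
    obtain ⟨x, hx, hx', hX⟩ := hX
    obtain ⟨i, rfl⟩ : ∃ i, x = i + 1 := ⟨x - 1, by omega⟩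
    have hi : i < C.nx - 1 := by omega
    have hi0 := hp 0 i (Nat.zero_le _) hi
    have m1 := edgeAngle_antitone_of_nonpos hq0 hi0
    have m2 := monotone_edgeAngle_sub_of_nonpos hq0 hq hi0
    simp only [zero_add] at m1 m2
    refine ⟨P y (i + 1 + 1, y + 1), P y (i + 1, y + 1), (hc.ne hl hi).symm, ?_, ?_⟩
    · have hw := hc.component_nonneg hl hi (ω := Ω - edgeAngle q (C.slopeX 1))
        (by linarith [(edgeAngle_mem q (C.slopeX (i + 1))).1])
        (by linarith [(edgeAngle_mem q (C.slopeX (i + 1))).2])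
      have hw' := mul_nonneg hq'.le hw
      rw [cross_swap, neg_nonneg]
      refine cross_nonpos_of_corners ?_ ?_ ?_ ?_ hX
      · rw [hcx _ (by omega) (by omega), hAA]; linarith
      · rw [hcx _ (by omega) (by omega), hBB]; linarith
      · rw [hAA]
      · rw [hBB]
    · intro Y hY
      have hw := hc.component_nonneg hl hi (ω := Ω - edgeAngle r (C.slopeX 1))
        (by linarith [(edgeAngle_mem r (C.slopeX 1)).1])
        (by linarith [(edgeAngle_mem r (C.slopeX (i + 1))).2])
      have hw' := mul_nonneg hr'.le hw
      refine cross_nonpos_of_mem_stripRegion (C := C) (fun x hx hx' => ?_) hY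
      obtain ⟨k, rfl⟩ : ∃ k, x = k + 1 := ⟨x - 1, by omega⟩
      have h := cross_nonneg_of_nonpos_slope (c := fun m => P y (m, y + 1))
        (d := fun m => P (y + 1) (m, y + 1)) (k := k) hl hp hq0 hq hc hd (by simp) hg1 hrad1 hi
        (by omega)
      simp only [cross_swap (P y (i + 1, y + 1)), neg_nonpos]
      refine ⟨h, ?_⟩
      rw [hdx _ hx hx']
      linarith
  · -- The lower chain turns to the right and the upper chain to the left: the line through the
    -- common edge separates the strips.
    have hN0 : 0 < C.nx - 1 := by omega
    have hA := edgeAngle_mem q (C.slopeX 1)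
    have hB := edgeAngle_mem r (C.slopeX 1)
    refine disjoint_interior_of_cross fun X hX =>
      ⟨P (y + 1) (1, y + 1), P (y + 1) (2, y + 1), hd.ne hl hN0, ?_, fun Y hY => ?_⟩
    · have hw := hd.component_nonneg hl hN0 (ω := Ω - edgeAngle r (C.slopeX 1))
        (by simp only [zero_add]; linarith) (by simp only [zero_add]; linarith)
      have hw' := mul_nonneg hr'.le hw
      rw [← neg_nonpos, ← cross_swap]
      refine cross_nonpos_of_mem_stripRegion (C := C) (fun x hx hx' => ?_) hX
      obtain ⟨k, rfl⟩ : ∃ k, x = k + 1 := ⟨x - 1, by omega⟩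
      have h : 0 ≤ Cap.cross (P (y + 1) (1, y + 1)) (P (y + 1) (2, y + 1))
          (P (y + 1) (k + 1, y + 1)) := by
        refine (hd.cross_eq_sum hd rfl hN0 (by omega : k ≤ C.nx - 1)).symm ▸
          mul_nonneg (hl 0).le ?_
        rw [Finset.sum_range_zero, sub_zero]
        refine Finset.sum_nonneg fun j hj => mul_nonneg (hl j).le ?_
        have hj' : j < C.nx - 1 := by have := Finset.mem_range.1 hj; omega
        have := edgeAngle_antitone_of_nonpos hr (hp 0 j (Nat.zero_le _) hj')
        have hj1 := edgeAngle_mem r (C.slopeX (j + 1))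
        simp only [zero_add] at this ⊢
        exact Real.sin_nonneg_of_nonneg_of_le_pi (by linarith) (by linarith)
      simp only [cross_swap (P (y + 1) (1, y + 1)), neg_nonpos]
      refine ⟨h, ?_⟩
      rw [hdx _ hx hx']
      exact add_nonneg h hw'
    · have hw := hd.component_nonneg hl hN0 (ω := Ω - edgeAngle q (C.slopeX 1))
        (by simp only [zero_add]; linarith) (by simp only [zero_add]; linarith)
      have hw' := mul_nonneg hq'.le hw
      refine cross_nonpos_of_mem_stripRegion (C := C) (fun x hx hx' => ?_) hY
      obtain ⟨k, rfl⟩ : ∃ k, x = k + 1 := ⟨x - 1, by omega⟩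
      have h : Cap.cross (P (y + 1) (1, y + 1)) (P (y + 1) (2, y + 1))
          (P y (k + 1, y + 1)) ≤ 0 := by
        refine (hd.cross_eq_sum hc hg1.symm hN0 (by omega : k ≤ C.nx - 1)).symm ▸
          mul_nonpos_of_nonneg_of_nonpos (hl 0).le ?_
        rw [Finset.sum_range_zero, sub_zero]
        refine Finset.sum_nonpos fun j hj => mul_nonpos_of_nonneg_of_nonpos (hl j).le ?_
        have hj' : j < C.nx - 1 := by have := Finset.mem_range.1 hj; omega
        have := monotone_edgeAngle hq0 (hp 0 j (Nat.zero_le _) hj')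
        have hj1 := edgeAngle_mem q (C.slopeX (j + 1))
        simp only [zero_add] at this ⊢
        exact Real.sin_nonpos_of_nonpos_of_neg_pi_le (by linarith) (by linarith)
      refine ⟨?_, h⟩
      rw [hcx _ hx hx']
      exact sub_nonpos.2 (h.trans hw')
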